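/- **Setting.** Let $N,d\ge 0$ be integers and $\mathcal V=\{1,\dots,N\}$. Robot $i\in\mathcal V$ has a state space $X_i\subseteq\mathbb R^{d}$, a control set $U_i\subseteq\mathbb R^{m_i}$, dynamics $f_i:X_i\times U_i\to\mathbb R^d$, an obstacle region $X_i^O\subseteq X_i$ and a closed goal region $X_i^G\subseteq X_i\setminus X_i^O$. Let $\|\cdot\|$ be the Euclidean norm and $\sigma>0$ a safety distance, and suppose $\|x_i-x_j\|\ge\sigma$ for all $x\in\prod_k X_k^G$ and $i\ne j$. Put $$X_i^F=\{y\in X_i\setminus X_i^O:\ \|y-z\|\ge\sigma\ \ \forall j\neq i,\ \forall z\in X_j^G\},\quad \mathbf X=\prod_i X_i,\quad \mathbf S=\Big\{x\in\prod_i X_i^F:\ \|x_i-x_j\|\ge\sigma\ \ \forall i\ne j\Big\},$$ and suppose that $\mathbf S$ is closed. Put $F_i(y)=\{f_i(y,u):u\in U_i\}$. **Assumption 1.** For every $i$: $X_i$ and $U_i$ are nonempty and compact; $f_i$ is continuous on $X_i\times U_i$; there is $c_i\ge0$ with $\|f_i(y,u)\|\le c_i(\|y\|+\|u\|+1)$ on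 $X_i\times U_i$; $F_i(y)$ is convex for every $y\in X_i$; and $F_i$ is Lipschitz on $X_i$ for the Hausdorff distance. All solutions of differential equations and inclusions are Carathéodory solutions (absolutely continuous, with the relation holding at almost every time). **Extended dynamics.** For $(x,t)\in\mathbf X\times\mathbb R^N$ let $\Phi(x,t)=\prod_i\Phi_i(x_i,t_i)$, where $\Phi_i(x_i,t_i)=F_i(x_i)\times\{-1\}$ if $x_i\notin X_i^G$ and $\Phi_i(x_i,t_i)=\overline{\mathrm{co}}\big((F_i(x_i)\times\{-1\})\cup\{(0,0)\}\big)$ if $x_i\in X_i^G$. Let $\mathcal S=\mathbf S\times\mathbb R^N_{\ge0}$. The viability kernel $\mathrm{Viab}_\Phi(\mathcal S)$ is the set of $(x,t)\in\mathcal S$ from which some solution of $(\dot x,\dot t)\in\Phi(x,t)$ on $[0,\infty)$ stays in $\mathcal S$ forever. **Minimal arrival times.** A policy $\pi=(\pi_i)_i$ assigns to every joint state $x\in\mathbf X$ and every robot $i$ a control $\pi_i(x)\in U_i$ or, only if $x_i\in X_i^G$, the command to rest; under $\pi$ robot $i$ moves with $\dot x_i=f_i(x_i,\pi_i(x))$,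 respectively $\dot x_i=0$ when it rests. For $x\in\mathbf X$, a policy $\pi$ and a curve $\xi:[0,\infty)\to(\mathbb R^d)^N$, let $\vartheta(x,\pi,\xi)\in[0,\infty]^N$ be the infimum, in the product order $\preceq$ of $[0,\infty]^N$, of all $t\in[0,\infty]^N$ such that $\xi(0)=x$; for $0\le s\le\max_i t_i$ (with $s$ finite) $\xi$ is a solution of the closed loop under $\pi$ and $\xi(s)\in\mathbf S$; and $\xi_i(t_i)\in X_i^G$ for every $i$ with $t_i<\infty$. The infimum of the empty set is $(\infty,\dots,\infty)$. Let $\varTheta^*(x)$ be the set of all $\vartheta(x,\pi,\xi)$ for which there is no pair $(\pi',\xi')$ with $\vartheta(x,\pi',\xi')\ne\vartheta(x,\pi,\xi)$ and $\vartheta(x,\pi',\xi')\preceq\vartheta(x,\pi,\xi)$. Its epigraph is $\mathcal Epi(\varTheta^*)=\{(x,t)\in\mathbf X\times\mathbb R^N:\ \exists\,t'\in\varTheta^*(x),\ t'\preceq t\}$. **Theorem.** Under Assumption 1, $\mathrm{Viab}_\Phi(\mathcal S)=\mathcal Epi(\varTheta^*)$. -/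

import Mathlib

open Set MeasureTheory
open scoped ENNReal NNReal

noncomputable section

/-- `y` is a Carathéodory solution of the differential inclusion `y' ∈ V(y)` on `[0, T]`:
it is absolutely continuous and satisfies the inclusion at almost every time. -/
def IsSolutionOn {E : Type*} [NormedAddCommGroup E] [NormedSpace ℝ E]
    (V : E → Set E) (y : ℝ → E) (T : ℝ) : Prop :=
  AbsolutelyContinuousOnInterval y 0 T ∧
    ∀ᵐ s : ℝ, s ∈ Ioo 0 T → ∃ v ∈ V (y s), HasDerivAt y v s

/-- The viability kernel of `D` for the dynamics `V`: the points of `D` from which some solution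
on `[0, ∞)` stays in `D` forever. -/
def viabilityKernel {E : Type*} [NormedAddCommGroup E] [NormedSpace ℝ E]
    (V : E → Set E) (D : Set E) : Set E :=
  {p | p ∈ D ∧ ∃ y : ℝ → E, y 0 = p ∧ (∀ T : ℝ, 0 ≤ T → IsSolutionOn V y T) ∧
    ∀ s : ℝ, 0 ≤ s → y s ∈ D}

/-- Joint states of `N` robots moving in `ℝᵈ`. -/
abbrev TeamState (N d : ℕ) : Type := Fin N → EuclideanSpace ℝ (Fin d)

/-- The data of a team of `N` robots with states in `ℝᵈ`, robot `i` having controls in `ℝ^(m i)`. -/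
structure RobotTeam (N d : ℕ) (m : Fin N → ℕ) where
  /-- state spaces -/
  X : Fin N → Set (EuclideanSpace ℝ (Fin d))
  /-- control sets -/
  U : (i : Fin N) → Set (EuclideanSpace ℝ (Fin (m i)))
  /-- dynamics; only the values on `X i × U i` matter -/
  f : (i : Fin N) → EuclideanSpace ℝ (Fin d) → EuclideanSpace ℝ (Fin (m i)) →
    EuclideanSpace ℝ (Fin d)
  /-- obstacle regions -/
  obstacle : Fin N → Set (EuclideanSpace ℝ (Fin d))
  /-- goal regions -/
  goal : Fin N → Set (EuclideanSpace ℝ (Fin d))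
  /-- minimum safety distance -/
  σ : ℝ

namespace RobotTeam

variable {N d : ℕ} {m : Fin N → ℕ} (R : RobotTeam N d m)

/-- `F_i(y) = {f_i(y, u) | u ∈ U_i}`. -/
def F (i : Fin N) (y : EuclideanSpace ℝ (Fin d)) : Set (EuclideanSpace ℝ (Fin d)) :=
  R.f i y '' R.U i

/-- The joint state space `∏ X_i`. -/
def stateSpace : Set (TeamState N d) := {x | ∀ i, x i ∈ R.X i}

/-- The joint goal region `∏ X_i^G`. -/
def jointGoal : Set (TeamState N d) := {x | ∀ i, x i ∈ R.goal i}

/-- The free region of robot `i`: no obstacle, and safely away from the goals of the others. -/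
def freeRegion (i : Fin N) : Set (EuclideanSpace ℝ (Fin d)) :=
  {y | y ∈ R.X i \ R.obstacle i ∧ ∀ j, j ≠ i → ∀ z ∈ R.goal j, R.σ ≤ ‖y - z‖}

/-- The safety region. -/
def safeRegion : Set (TeamState N d) :=
  {x | (∀ i, x i ∈ R.freeRegion i) ∧ ∀ i j, i ≠ j → R.σ ≤ ‖x i - x j‖}

/-- The standing conventions of the motion planning problem. -/
structure IsWellFormed : Prop where
  obstacle_subset : ∀ i, R.obstacle i ⊆ R.X i
  goal_subset : ∀ i, R.goal i ⊆ R.X i \ R.obstacle i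
  σ_pos : 0 < R.σ
  goal_separated : ∀ x ∈ R.jointGoal, ∀ i j, i ≠ j → R.σ ≤ ‖x i - x j‖

/-- The regularity assumption on the dynamics. -/
structure IsRegular : Prop where
  X_nonempty : ∀ i, (R.X i).Nonempty
  X_compact : ∀ i, IsCompact (R.X i)
  U_nonempty : ∀ i, (R.U i).Nonempty
  U_compact : ∀ i, IsCompact (R.U i)
  f_continuous : ∀ i, ContinuousOn (fun p : EuclideanSpace ℝ (Fin d) ×
    EuclideanSpace ℝ (Fin (m i)) => R.f i p.1 p.2) (R.X i ×ˢ R.U i)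
  linear_growth : ∀ i, ∃ c : ℝ, 0 ≤ c ∧ ∀ y ∈ R.X i, ∀ u ∈ R.U i,
    ‖R.f i y u‖ ≤ c * (‖y‖ + ‖u‖ + 1)
  F_convex : ∀ i, ∀ y ∈ R.X i, Convex ℝ (R.F i y)
  F_lipschitz : ∀ i, ∃ l : ℝ, 0 ≤ l ∧ ∀ y ∈ R.X i, ∀ z ∈ R.X i,
    Metric.hausdorffDist (R.F i y) (R.F i z) ≤ l * ‖y - z‖

/-! ### Extended dynamics with countdown clocks -/

open Classical in
/-- `Φ_i`: outside its goal robot `i` moves and its clock runs down at unit speed; inside the goal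
the robot may also rest with its clock stopped. -/
def Φi (i : Fin N) (y : EuclideanSpace ℝ (Fin d)) : Set (EuclideanSpace ℝ (Fin d) × ℝ) :=
  if y ∈ R.goal i then closedConvexHull ℝ (R.F i y ×ˢ {(-1 : ℝ)} ∪ {(0, 0)})
  else R.F i y ×ˢ {(-1 : ℝ)}

/-- `Φ(x, t) = ∏ Φ_i(x_i, t_i)`. -/
def Φ (p : TeamState N d × (Fin N → ℝ)) : Set (TeamState N d × (Fin N → ℝ)) :=
  {w | ∀ i, (w.1 i, w.2 i) ∈ R.Φi i (p.1 i)}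

/-- The safety-time region `S × ℝ^N_{≥0}`. -/
def safeTime : Set (TeamState N d × (Fin N → ℝ)) :=
  R.safeRegion ×ˢ {t | ∀ i, 0 ≤ t i}

/-! ### Feedback policies, arrival times, Pareto optimality -/

/-- Feedback commands for each robot as functions of the joint state: `some u` applies the control
`u`, and `none` means that the robot rests. -/
abbrev Policy (_ : RobotTeam N d m) : Type :=
  (i : Fin N) → TeamState N d → Option (EuclideanSpace ℝ (Fin (m i)))

/-- Controls are taken in `U_i`, and a robot may rest only in its goal region. -/
def IsAdmissible (π : R.Policy) : Prop :=
  ∀ x ∈ R.stateSpace, ∀ i, (∀ u, π i x = some u → u ∈ R.U i) ∧ (π i x = none → x i ∈ R.goal i)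

/-- The velocity of the team in the state `x` under the policy `π`. -/
def velocity (π : R.Policy) (x : TeamState N d) : TeamState N d :=
  fun i => (π i x).elim 0 (R.f i (x i))

/-- The vectors `t ∈ [0, ∞]^N` such that up to time `max_i t_i` the curve `ξ` starts at `x`,
follows the policy `π` and stays safe, and `ξ_i(t_i)` lies in the goal of robot `i` whenever `t_i`
is finite. -/
def arrivalVectors (x : TeamState N d) (π : R.Policy) (ξ : ℝ → TeamState N d) :
    Set (Fin N → ℝ≥0∞) :=
  {t | ξ 0 = x ∧
    (∀ T : ℝ≥0, (∃ j, (T : ℝ≥0∞) ≤ t j) →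
      IsSolutionOn (fun y => {R.velocity π y}) ξ T ∧ ξ T ∈ R.safeRegion) ∧
    ∀ i, t i ≠ ∞ → ξ (t i).toReal i ∈ R.goal i}

/-- The vector of minimal arrival times when the team starts from `x` and executes `π` along `ξ`,
an infimum in the product order of `[0, ∞]^N` (with all entries `∞` if there is no arrival
vector). -/
def arrivalTime (x : TeamState N d) (π : R.Policy) (ξ : ℝ → TeamState N d) : Fin N → ℝ≥0∞ :=
  sInf (R.arrivalVectors x π ξ)

/-- The Pareto optimal executions from `x`: pairs of an admissible policy and a curve whose
arrival time vector is not dominated by a different one. -/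
def paretoOptimal (x : TeamState N d) : Set (R.Policy × (ℝ → TeamState N d)) :=
  {e | R.IsAdmissible e.1 ∧ ¬ ∃ (π : R.Policy) (ξ : ℝ → TeamState N d), R.IsAdmissible π ∧
    R.arrivalTime x π ξ ≠ R.arrivalTime x e.1 e.2 ∧
    R.arrivalTime x π ξ ≤ R.arrivalTime x e.1 e.2}

/-- The Pareto minimal arrival time map `Θ*`. -/
def minimalArrival (x : TeamState N d) : Set (Fin N → ℝ≥0∞) :=
  (fun e => R.arrivalTime x e.1 e.2) '' R.paretoOptimal x

/-- The epigraph, in `X × ℝ^N`, of a set-valued map with values in `[0, ∞]^N`. -/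
def epigraph (Θ : TeamState N d → Set (Fin N → ℝ≥0∞)) : Set (TeamState N d × (Fin N → ℝ)) :=
  {p | p.1 ∈ R.stateSpace ∧ ∃ t' ∈ Θ p.1, ∀ i, (t' i : EReal) ≤ ((p.2 i : ℝ) : EReal)}

end RobotTeam

end

/-! ### Absolutely continuous curves, slopes and closed convex sets -/

section

open Filter Topology

/-! Both sides equal the set of `(x, t)` for which some run (`IsRun`) from `x` has stopping times `τ
≤ t`.

Outside its goal a robot's clock falls at unit speed, so viability forces a first hit of each goal
no later than `t i`. Stopping each robot at its first hit gives a run (`IsRun.of_stop`). This is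
safe because free regions keep away from the other robots' goals. Conversely, clocks that stop with
the robots make a run viable. A finite arrival vector likewise consists of first hitting times,
hence comes from a run.

It remains to place a run above a Pareto optimal feedback execution. Runs with bounded stopping
times are compact for pointwise convergence (`isCompact_setOf_isRun`), so a minimal run exists below
any given one. Minimality forbids loops (`IsRun.exists_lt_of_eq`): the joint state then determines
the time until the last stop, and the open-loop motion is feedback
(`IsRun.exists_policy_of_minimal`). Policies need no regularity, so controls are chosen pointwise.
-/

theorem LipschitzWith.comp_absolutelyContinuousOnInterval {X Y : Type*} [PseudoMetricSpace X]
    [PseudoMetricSpace Y] {g : X → Y} {K : ℝ≥0} (hg : LipschitzWith K g) {f : ℝ → X} {a b : ℝ}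
    (hf : AbsolutelyContinuousOnInterval f a b) :
    AbsolutelyContinuousOnInterval (fun s => g (f s)) a b := by
  refine squeeze_zero (fun E => Finset.sum_nonneg fun i _ => dist_nonneg) (fun E => ?_)
    (by simpa using Tendsto.const_mul (K : ℝ) hf)
  rw [Finset.mul_sum]
  exact Finset.sum_le_sum fun i _ => hg.dist_le_mul _ _

/-- The fundamental theorem of calculus for absolutely continuous functions: the increment is the
integral of the derivative. -/
theorem AbsolutelyContinuousOnInterval.sub_le_of_ae_hasDerivAt_le {f : ℝ → ℝ} {a b c : ℝ}
    (hab : a ≤ b) (hf : AbsolutelyContinuousOnInterval f a b)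
    (h : ∀ᵐ s : ℝ, s ∈ Ioo a b → ∃ v ≤ c, HasDerivAt f v s) : f b - f a ≤ c * (b - a) := by
  rw [← hf.integral_deriv_eq_sub]
  have hle : ∫ s in a..b, deriv f s ≤ ∫ _ in a..b, c := by
    refine intervalIntegral.integral_mono_ae_restrict hab hf.intervalIntegrable_deriv
      intervalIntegrable_const ?_
    rw [EventuallyLE, ← restrict_Ioo_eq_restrict_Icc, ae_restrict_iff' measurableSet_Ioo]
    filter_upwards [h] with s hs hsab
    obtain ⟨v, hv, hd⟩ := hs hsab
    rwa [hd.deriv]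
  simpa [mul_comm] using hle

/-- Mean value theorem for absolutely continuous curves and closed convex sets. -/
theorem AbsolutelyContinuousOnInterval.slope_mem_of_ae_hasDerivAt_mem {E : Type*}
    [NormedAddCommGroup E] [NormedSpace ℝ E] {f : ℝ → E} {a b : ℝ} {K : Set E} (hab : a < b)
    (hf : AbsolutelyContinuousOnInterval f a b) (hK : Convex ℝ K) (hKc : IsClosed K)
    (h : ∀ᵐ s : ℝ, s ∈ Ioo a b → ∃ v ∈ K, HasDerivAt f v s) : slope f a b ∈ K := by
  by_contra hn
  -- A functional separating the slope from `K` reduces the claim to the scalar bound for `p ∘ f`.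
  obtain ⟨p, u, hp, hu⟩ := geometric_hahn_banach_closed_point hK hKc hn
  have hac := p.lipschitz.comp_absolutelyContinuousOnInterval hf
  have hle := hac.sub_le_of_ae_hasDerivAt_le (c := u) hab.le (by
    filter_upwards [h] with s hs hsab
    obtain ⟨v, hv, hd⟩ := hs hsab
    exact ⟨p v, (hp v hv).le, p.hasFDerivAt.comp_hasDerivAt s hd⟩)
  have hpos : 0 < b - a := sub_pos.2 hab
  rw [slope_def_module, map_smul, map_sub, smul_eq_mul, inv_mul_eq_div, lt_div_iff₀ hpos] at hu
  linarith

theorem AbsolutelyContinuousOnInterval.norm_sub_le_of_ae_hasDerivAt {E : Type*}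
    [NormedAddCommGroup E] [NormedSpace ℝ E] {f : ℝ → E} {a b C : ℝ} (hab : a ≤ b)
    (hf : AbsolutelyContinuousOnInterval f a b)
    (h : ∀ᵐ s : ℝ, s ∈ Ioo a b → ∃ v, ‖v‖ ≤ C ∧ HasDerivAt f v s) :
    ‖f b - f a‖ ≤ C * (b - a) := by
  rcases hab.eq_or_lt with rfl | hlt
  · simp
  have hm := hf.slope_mem_of_ae_hasDerivAt_mem (K := Metric.closedBall 0 C) hlt
    (convex_closedBall _ _) Metric.isClosed_closedBall (by simpa using h)
  have hpos : 0 < b - a := sub_pos.2 hlt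
  rw [mem_closedBall_zero_iff, slope_def_module, norm_smul, norm_inv, Real.norm_of_nonneg hpos.le,
    inv_mul_eq_div, div_le_iff₀ hpos] at hm
  exact hm

/-- A differentiable curve whose forward slopes at `a` are `O(b - a)`-close to a closed set has its
derivative at `a` in that set. -/
theorem HasDerivAt.mem_of_infDist_slope_le {E : Type*} [NormedAddCommGroup E] [NormedSpace ℝ E]
    {f : ℝ → E} {v : E} {a r C : ℝ} {K : Set E} (hd : HasDerivAt f v a) (hK : IsClosed K)
    (hne : K.Nonempty) (har : a < r)
    (h : ∀ b, a < b → b < r → Metric.infDist (slope f a b) K ≤ C * (b - a)) : v ∈ K := by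
  rw [hK.mem_iff_infDist_zero hne]
  refine le_antisymm ?_ Metric.infDist_nonneg
  have h1 : Tendsto (slope f a) (𝓝[>] a) (𝓝 v) :=
    (hasDerivAt_iff_tendsto_slope.1 hd).mono_left
      (nhdsWithin_mono _ fun b hb => ne_of_gt hb)
  have h2 : Tendsto (fun b => Metric.infDist (slope f a b) K) (𝓝[>] a) (𝓝 (Metric.infDist v K)) :=
    ((Metric.continuous_infDist_pt K).tendsto v).comp h1
  have h3 : Tendsto (fun b => C * (b - a)) (𝓝[>] a) (𝓝 0) := by
    have : Tendsto (fun b => C * (b - a)) (𝓝 a) (𝓝 (C * (a - a))) :=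
      (by fun_prop : Continuous fun b => C * (b - a)).tendsto a
    simpa using this.mono_left nhdsWithin_le_nhds
  refine le_of_tendsto_of_tendsto h2 h3 ?_
  filter_upwards [Ioo_mem_nhdsGT har] with b hb
  exact h b hb.1 hb.2

/-! ### Runs and their velocities -/

namespace RobotTeam

variable {N d : ℕ} {m : Fin N → ℕ} {R : RobotTeam N d m}

/-- `K i` bounds the speed of robot `i` and `L i` is a Lipschitz constant of `F_i`. -/
structure IsBound (R : RobotTeam N d m) (K : Fin N → ℝ≥0) (L : Fin N → ℝ) : Prop where
  speed : ∀ i, ∀ y ∈ R.X i, ∀ v ∈ R.F i y, ‖v‖ ≤ K i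
  nonneg : ∀ i, 0 ≤ L i
  lipschitz : ∀ i, ∀ y ∈ R.X i, ∀ z ∈ R.X i,
    Metric.hausdorffDist (R.F i y) (R.F i z) ≤ L i * ‖y - z‖

/-- A safe motion from `x`, controlled in open loop, in which robot `i` moves until the time `τ i`
and rests in its goal afterwards. The dynamics are expressed by a bound on the distance of the
slopes to the set of velocities, which passes to pointwise limits. -/
structure IsRun (R : RobotTeam N d m) (K : Fin N → ℝ≥0) (L : Fin N → ℝ) (x : TeamState N d)
    (ξ : ℝ → TeamState N d) (τ : Fin N → ℝ) : Prop where
  start : ξ 0 = x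
  safe : ∀ s, ξ s ∈ R.safeRegion
  lipschitz : ∀ i, LipschitzWith (K i) fun s => ξ s i
  nonneg : ∀ i, 0 ≤ τ i
  arrived : ∀ i s, τ i < s → ξ s i ∈ R.goal i
  rests : ∀ i s r, τ i < s → s ≤ r → ξ r i = ξ s i
  moves : ∀ i a b, 0 ≤ a → a < b → b < τ i →
    Metric.infDist (slope (fun s => ξ s i) a b) (R.F i (ξ a i)) ≤ L i * K i * (b - a)

theorem safeRegion_subset_stateSpace : R.safeRegion ⊆ R.stateSpace := fun _ hx i => (hx.1 i).1.1

theorem IsRegular.F_nonempty (hreg : R.IsRegular) (i : Fin N) (y : EuclideanSpace ℝ (Fin d)) :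
    (R.F i y).Nonempty := (hreg.U_nonempty i).image _

theorem IsRegular.isCompact_F (hreg : R.IsRegular) (i : Fin N) {y : EuclideanSpace ℝ (Fin d)}
    (hy : y ∈ R.X i) : IsCompact (R.F i y) :=
  (hreg.U_compact i).image_of_continuousOn
    ((hreg.f_continuous i).comp (f := fun u => (y, u)) (by fun_prop) fun _ hu => ⟨hy, hu⟩)

theorem IsRegular.exists_isBound (hreg : R.IsRegular) : ∃ K L, R.IsBound K L := by
  have h : ∀ i, ∃ k : ℝ≥0, ∀ y ∈ R.X i, ∀ v ∈ R.F i y, ‖v‖ ≤ k := by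
    intro i
    obtain ⟨c, hc⟩ := ((hreg.X_compact i).prod (hreg.U_compact i)).exists_bound_of_continuousOn
      (hreg.f_continuous i)
    refine ⟨c.toNNReal, ?_⟩
    rintro y hy _ ⟨u, hu, rfl⟩
    exact (hc (y, u) ⟨hy, hu⟩).trans (Real.le_coe_toNNReal c)
  choose K hK using h
  choose L hL using hreg.F_lipschitz
  exact ⟨K, L, hK, fun i => (hL i).1, fun i => (hL i).2⟩

theorem IsRegular.infDist_F_le (hreg : R.IsRegular) {K : Fin N → ℝ≥0} {L : Fin N → ℝ}
    (hb : R.IsBound K L) (i : Fin N) {y z : EuclideanSpace ℝ (Fin d)} (hy : y ∈ R.X i)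
    (hz : z ∈ R.X i) (v : EuclideanSpace ℝ (Fin d)) :
    Metric.infDist v (R.F i y) ≤ Metric.infDist v (R.F i z) + L i * ‖z - y‖ :=
  (Metric.infDist_le_infDist_add_hausdorffDist
    -- The real-valued Hausdorff distance is `0` when the extended one is infinite; nonempty bounded
    -- sets exclude this.
    (Metric.hausdorffEDist_ne_top_of_nonempty_of_bounded (hreg.F_nonempty i z)
      (hreg.F_nonempty i y) (hreg.isCompact_F i hz).isBounded
      (hreg.isCompact_F i hy).isBounded)).trans
    (add_le_add_right (hb.lipschitz i z hz y hy) _)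

theorem IsRegular.continuousOn_infDist_F (hreg : R.IsRegular) (i : Fin N) :
    ContinuousOn (fun p : EuclideanSpace ℝ (Fin d) × EuclideanSpace ℝ (Fin d) =>
      Metric.infDist p.1 (R.F i p.2)) (univ ×ˢ R.X i) := by
  obtain ⟨K, L, hb⟩ := hreg.exists_isBound
  refine (LipschitzOnWith.of_le_add_mul (1 + (L i).toNNReal) fun p hp q hq => ?_).continuousOn
  have h1 := hreg.infDist_F_le hb i hp.2 hq.2 p.1
  have h2 := Metric.infDist_le_infDist_add_dist (s := R.F i q.2) (x := p.1) (y := q.1)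
  have h3 : dist p.1 q.1 ≤ dist p q := le_max_left _ _
  have h4 : ‖q.2 - p.2‖ ≤ dist p q := by
    rw [← dist_eq_norm, dist_comm]
    exact le_max_right _ _
  have h5 := mul_le_mul_of_nonneg_left h4 (hb.nonneg i)
  push_cast
  rw [Real.coe_toNNReal _ (hb.nonneg i)]
  linarith

/-- Stopping every robot in its goal at the time `τ i` turns a motion into a run. -/
theorem IsRun.of_stop (hreg : R.IsRegular) {K : Fin N → ℝ≥0} {L : Fin N → ℝ}
    (hb : R.IsBound K L) {y : ℝ → TeamState N d} {τ : Fin N → ℝ} (hτ : ∀ i, 0 ≤ τ i)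
    (hac : ∀ i, AbsolutelyContinuousOnInterval (fun s => y s i) 0 (τ i))
    (hd : ∀ i, ∀ᵐ s : ℝ, s ∈ Ioo 0 (τ i) → ∃ v ∈ R.F i (y s i), HasDerivAt (fun s => y s i) v s)
    (hg : ∀ i, y (τ i) i ∈ R.goal i)
    (hs : ∀ s, 0 ≤ s → (∃ j, s ≤ τ j) → y s ∈ R.safeRegion) :
    R.IsRun K L (y 0) (fun s i => y (max 0 (min s (τ i))) i) τ := by
  have hX : ∀ i s, 0 ≤ s → s ≤ τ i → y s i ∈ R.X i := fun i s h0 h1 =>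
    safeRegion_subset_stateSpace (hs s h0 ⟨i, h1⟩) i
  have hclamp : ∀ i s, max 0 (min s (τ i)) ∈ Icc 0 (τ i) := fun i s =>
    ⟨le_max_left _ _, max_le (hτ i) (min_le_right _ _)⟩
  have hsub : ∀ i a b, 0 ≤ a → a ≤ b → b ≤ τ i → ‖y b i - y a i‖ ≤ K i * (b - a) := by
    intro i a b ha hab hbτ
    refine ((hac i).mono ?_).norm_sub_le_of_ae_hasDerivAt hab ?_
    · rw [uIcc_of_le hab, uIcc_of_le (hτ i)]
      exact Icc_subset_Icc ha hbτ
    · filter_upwards [hd i] with s hsd hsab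
      have h0 : 0 < s := ha.trans_lt hsab.1
      have h1 : s < τ i := hsab.2.trans_le hbτ
      obtain ⟨v, hv, hdv⟩ := hsd ⟨h0, h1⟩
      exact ⟨v, hb.speed i _ (hX i s h0.le h1.le) v hv, hdv⟩
  have hlip : ∀ i, LipschitzOnWith (K i) (fun s => y s i) (Icc 0 (τ i)) := by
    intro i
    refine LipschitzOnWith.of_dist_le_mul fun a ha b hb' => ?_
    rcases le_total a b with hab | hab
    · rw [dist_comm, dist_comm a, dist_eq_norm, Real.dist_eq, abs_of_nonneg (sub_nonneg.2 hab)]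
      exact hsub i a b ha.1 hab hb'.2
    · rw [dist_eq_norm, Real.dist_eq, abs_of_nonneg (sub_nonneg.2 hab)]
      exact hsub i b a hb'.1 hab ha.2
  refine ⟨?_, ?_, ?_, hτ, ?_, ?_, ?_⟩
  · funext i
    simp [min_eq_left (hτ i)]
  · intro s
    have hfree : ∀ i, y (max 0 (min s (τ i))) i ∈ R.freeRegion i := fun i =>
      (hs _ (hclamp i s).1 ⟨i, (hclamp i s).2⟩).1 i
    -- Either robot `i` is in its goal, or it is observed at the common time `max 0 s`. A pair with
    -- a robot in its goal is separated by the free region of the other; two moving robots are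
    -- separated by safety of `y` at that time.
    have hval : ∀ i, y (max 0 (min s (τ i))) i ∈ R.goal i ∨
        (max 0 s ≤ τ i ∧ max 0 (min s (τ i)) = max 0 s) := by
      intro i
      rcases le_total (τ i) s with h | h
      · left
        rw [min_eq_right h, max_eq_right (hτ i)]
        exact hg i
      · exact Or.inr ⟨max_le (hτ i) h, by rw [min_eq_left h]⟩
    refine ⟨hfree, fun i j hij => ?_⟩
    rcases hval i with hi | ⟨hi, ei⟩
    · rw [norm_sub_rev]
      exact (hfree j).2 i hij _ hi
    rcases hval j with hj | ⟨hj, ej⟩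
    · exact (hfree i).2 j hij.symm _ hj
    · change R.σ ≤ ‖y (max 0 (min s (τ i))) i - y (max 0 (min s (τ j))) j‖
      rw [ei, ej]
      exact (hs _ (le_max_left _ _) ⟨i, hi⟩).2 i j hij
  · intro i
    have hc : LipschitzWith 1 fun s : ℝ => max 0 (min s (τ i)) :=
      (LipschitzWith.id.min_const (τ i)).const_max 0
    have := (hlip i).comp (hc.lipschitzOnWith (s := univ)) (fun s _ => hclamp i s)
    rw [mul_one, lipschitzOnWith_univ] at this
    exact this
  · intro i s his
    rw [min_eq_right his.le, max_eq_right (hτ i)]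
    exact hg i
  · intro i s r his hsr
    simp only [min_eq_right his.le, min_eq_right (his.le.trans hsr)]
  · intro i a b ha hab hbτ
    have hbτ' := hbτ.le
    have haτ := hab.le.trans hbτ'
    have e : ∀ s, 0 ≤ s → s ≤ τ i → max 0 (min s (τ i)) = s := fun s h0 h1 => by
      rw [min_eq_left h1, max_eq_right h0]
    simp only [slope_def_module, e a ha haτ, e b (ha.trans hab.le) hbτ']
    have hne := hreg.F_nonempty i (y a i)
    have hcl : Metric.cthickening (L i * K i * (b - a)) (R.F i (y a i)) =
        {v | Metric.infDist v (R.F i (y a i)) ≤ L i * K i * (b - a)} := by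
      ext v
      have h0 : 0 ≤ L i * K i * (b - a) :=
        mul_nonneg (mul_nonneg (hb.nonneg i) (K i).2) (sub_nonneg.2 hab.le)
      rw [Metric.mem_cthickening_iff, mem_ofPred_eq, Metric.infDist,
        ENNReal.le_ofReal_iff_toReal_le (Metric.infEDist_ne_top hne) h0]
    -- On `[a, b]` the robot moves by at most `K i * (b - a)`, so its velocities lie in a closed
    -- thickening of the set at time `a`. The thickening is convex, so it also contains the slope.
    have hmem := ((hac i).mono (c := a) (d := b) (by
        rw [uIcc_of_le hab.le, uIcc_of_le (hτ i)]
        exact Icc_subset_Icc ha hbτ')).slope_mem_of_ae_hasDerivAt_mem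
      (K := Metric.cthickening (L i * K i * (b - a)) (R.F i (y a i))) hab
      ((hreg.F_convex i _ (hX i a ha haτ)).cthickening _) Metric.isClosed_cthickening (by
        filter_upwards [hd i] with s hsd hsab
        have h0 : 0 < s := ha.trans_lt hsab.1
        have h1 : s < τ i := hsab.2.trans_le hbτ'
        obtain ⟨v, hv, hdv⟩ := hsd ⟨h0, h1⟩
        refine ⟨v, ?_, hdv⟩
        rw [hcl, mem_ofPred_eq]
        refine (hreg.infDist_F_le hb i (hX i a ha haτ) (hX i s h0.le h1.le) v).trans ?_
        rw [Metric.infDist_zero_of_mem hv, zero_add, mul_assoc]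
        refine mul_le_mul_of_nonneg_left ((hsub i a s ha hsab.1.le h1.le).trans ?_) (hb.nonneg i)
        exact mul_le_mul_of_nonneg_left (by linarith [hsab.2]) (K i).2)
    rw [hcl, mem_ofPred_eq, slope_def_module] at hmem
    exact hmem

/-- Runs demand arrival only strictly after `τ i`; continuity and closedness of the goal add the
endpoint. -/
theorem IsRun.arrived_of_le {K : Fin N → ℝ≥0} {L : Fin N → ℝ} {x : TeamState N d}
    {ξ : ℝ → TeamState N d} {τ : Fin N → ℝ} (h : R.IsRun K L x ξ τ)
    (hgoal : ∀ i, IsClosed (R.goal i)) {i : Fin N} {s : ℝ} (hs : τ i ≤ s) :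
    ξ s i ∈ R.goal i := by
  have ht : Tendsto (fun r => ξ r i) (𝓝[>] s) (𝓝 (ξ s i)) :=
    ((h.lipschitz i).continuous.tendsto s).mono_left nhdsWithin_le_nhds
  refine (hgoal i).mem_of_tendsto ht ?_
  filter_upwards [self_mem_nhdsWithin] with r hr
  exact h.arrived i r (hs.trans_lt hr)

theorem IsRun.hasDerivAt_zero {K : Fin N → ℝ≥0} {L : Fin N → ℝ} {x : TeamState N d}
    {ξ : ℝ → TeamState N d} {τ : Fin N → ℝ} (h : R.IsRun K L x ξ τ) {i : Fin N} {s : ℝ}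
    (hs : τ i < s) : HasDerivAt (fun s => ξ s i) 0 s := by
  obtain ⟨r, hr, hrs⟩ := exists_between hs
  refine (hasDerivAt_const s (ξ r i)).congr_of_eventuallyEq ?_
  filter_upwards [Ioi_mem_nhds hrs] with q hq
  exact h.rests i r q hr (le_of_lt hq)

/-- Lipschitz curves are differentiable almost everywhere, and the slope bound vanishes as the
interval shrinks. This recovers the inclusion from `moves`. -/
theorem IsRun.ae_hasDerivAt (hreg : R.IsRegular) {K : Fin N → ℝ≥0} {L : Fin N → ℝ}
    {x : TeamState N d} {ξ : ℝ → TeamState N d} {τ : Fin N → ℝ} (h : R.IsRun K L x ξ τ)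
    (i : Fin N) :
    ∀ᵐ s : ℝ, s ∈ Ioo 0 (τ i) → ∃ v ∈ R.F i (ξ s i), HasDerivAt (fun s => ξ s i) v s := by
  filter_upwards [(h.lipschitz i).ae_differentiableAt_real] with s hs hsτ
  refine ⟨_, ?_, hs.hasDerivAt⟩
  have hX := safeRegion_subset_stateSpace (h.safe s) i
  exact hs.hasDerivAt.mem_of_infDist_slope_le (hreg.isCompact_F i hX).isClosed
    (hreg.F_nonempty i _) hsτ.2 fun b hsb hbτ => h.moves i s b hsτ.1.le hsb hbτ

/-! ### Compactness of runs -/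

/-- The runs from `x` with arrival times bounded by `t` form a compact set for pointwise
convergence. -/
theorem isCompact_setOf_isRun (hreg : R.IsRegular) (hgoal : ∀ i, IsClosed (R.goal i))
    (hsafe : IsClosed R.safeRegion) (K : Fin N → ℝ≥0) (L : Fin N → ℝ) (x : TeamState N d)
    (t : Fin N → ℝ) :
    IsCompact {p : (ℝ → TeamState N d) × (Fin N → ℝ) | R.IsRun K L x p.1 p.2 ∧ p.2 ≤ t} := by
  have hXc : IsCompact R.stateSpace := by
    have : R.stateSpace = Set.pi univ R.X := by ext; simp [stateSpace]
    rw [this]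
    exact isCompact_univ_pi hreg.X_compact
  have hSc : IsCompact R.safeRegion := hXc.of_isClosed_subset hsafe safeRegion_subset_stateSpace
  have hbig : IsCompact ((Set.pi univ fun _ : ℝ => R.safeRegion) ×ˢ Icc (0 : Fin N → ℝ) t) :=
    (isCompact_univ_pi fun _ => hSc).prod isCompact_Icc
  have hev : ∀ s i, Continuous fun p : (ℝ → TeamState N d) × (Fin N → ℝ) => p.1 s i := by
    intro s i; fun_prop
  have hτ : ∀ i, Continuous fun p : (ℝ → TeamState N d) × (Fin N → ℝ) => p.2 i := by
    intro i; fun_prop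
  -- Tychonoff handles the product, so only closed conditions may be imposed. The strict
  -- inequalities in `IsRun` serve this purpose: their negations `s ≤ τ i` and `τ i ≤ b` are closed.
  -- Membership in `R.X i`, already implied by safety, is repeated because the distance to `F_i` is
  -- known to be continuous only there.
  have hset : {p : (ℝ → TeamState N d) × (Fin N → ℝ) | R.IsRun K L x p.1 p.2 ∧ p.2 ≤ t} =
      (((Set.pi univ fun _ : ℝ => R.safeRegion) ×ˢ Icc (0 : Fin N → ℝ) t) ∩
        {p | p.1 0 = x}) ∩
      (⋂ i, ⋂ s : ℝ, ⋂ r : ℝ, {p | dist (p.1 s i) (p.1 r i) ≤ K i * dist s r}) ∩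
      (⋂ i, ⋂ s : ℝ, {p | s ≤ p.2 i} ∪ {p | p.1 s i ∈ R.goal i}) ∩
      (⋂ i, ⋂ s : ℝ, ⋂ r : ℝ, ⋂ _ : s ≤ r, {p | s ≤ p.2 i} ∪ {p | p.1 r i = p.1 s i}) ∩
      (⋂ i, ⋂ a : ℝ, ⋂ b : ℝ, ⋂ _ : 0 ≤ a ∧ a < b,
        (({p | p.2 i ≤ b} ∪ {p | p.1 a i ∈ R.X i ∧
          Metric.infDist ((b - a)⁻¹ • (p.1 b i - p.1 a i)) (R.F i (p.1 a i)) ≤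
            L i * K i * (b - a)}))) := by
    ext ⟨ξ, τ⟩
    simp only [mem_ofPred_eq, mem_inter_iff, mem_prod, Set.mem_pi, mem_univ, true_imp_iff, mem_Icc,
      mem_iInter, mem_union]
    constructor
    · rintro ⟨h, ht⟩
      refine ⟨⟨⟨⟨⟨⟨h.safe, h.nonneg, ht⟩, h.start⟩, fun i s r => (h.lipschitz i).dist_le_mul s r⟩,
        fun i s => ?_⟩, fun i s r hsr => ?_⟩, fun i a b hab => ?_⟩
      · exact (le_or_gt s (τ i)).imp_right (h.arrived i s)
      · exact (le_or_gt s (τ i)).imp_right fun hs => h.rests i s r hs hsr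
      · refine (le_or_gt (τ i) b).imp_right fun hb => ⟨?_, ?_⟩
        · exact safeRegion_subset_stateSpace (h.safe a) i
        · simpa only [slope_def_module] using h.moves i a b hab.1 hab.2 hb
    · rintro ⟨⟨⟨⟨⟨⟨h1, h2, h3⟩, h4⟩, h5⟩, h6⟩, h7⟩, h8⟩
      refine ⟨⟨h4, h1, fun i => LipschitzWith.of_dist_le_mul (h5 i), h2, fun i s hs => ?_,
        fun i s r hs hsr => ?_, fun i a b ha hab hb => ?_⟩, h3⟩
      · exact (h6 i s).resolve_left hs.not_ge
      · exact (h7 i s r hsr).resolve_left hs.not_ge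
      · rw [slope_def_module]
        exact ((h8 i a b ⟨ha, hab⟩).resolve_left hb.not_ge).2
  rw [hset]
  refine (((hbig.inter_right ?_).inter_right ?_).inter_right ?_).inter_right ?_ |>.inter_right ?_
  · exact isClosed_eq (by fun_prop) continuous_const
  · exact isClosed_iInter fun i => isClosed_iInter fun s => isClosed_iInter fun r =>
      isClosed_le ((hev s i).dist (hev r i)) continuous_const
  · exact isClosed_iInter fun i => isClosed_iInter fun s =>
      (isClosed_le continuous_const (hτ i)).union ((hgoal i).preimage (hev s i))
  · exact isClosed_iInter fun i => isClosed_iInter fun s => isClosed_iInter fun r =>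
      isClosed_iInter fun _ =>
      (isClosed_le continuous_const (hτ i)).union (isClosed_eq (hev r i) (hev s i))
  · refine isClosed_iInter fun i => isClosed_iInter fun a => isClosed_iInter fun b =>
      isClosed_iInter fun _ => (isClosed_le (hτ i) continuous_const).union ?_
    have hXi : IsClosed {p : (ℝ → TeamState N d) × (Fin N → ℝ) | p.1 a i ∈ R.X i} :=
      (hreg.X_compact i).isClosed.preimage (hev a i)
    have hcont : ContinuousOn (fun p : (ℝ → TeamState N d) × (Fin N → ℝ) =>
        Metric.infDist ((b - a)⁻¹ • (p.1 b i - p.1 a i)) (R.F i (p.1 a i)))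
        {p | p.1 a i ∈ R.X i} :=
      (hreg.continuousOn_infDist_F i).comp
        (f := fun p : (ℝ → TeamState N d) × (Fin N → ℝ) =>
          ((b - a)⁻¹ • (p.1 b i - p.1 a i), p.1 a i))
        (by fun_prop)
        fun p hp => ⟨mem_univ _, hp⟩
    exact hcont.preimage_isClosed_of_isClosed hXi isClosed_Iic

end RobotTeam

theorem AbsolutelyContinuousOnInterval.apply {ι : Type*} [Fintype ι] {X : Type*}
    [PseudoMetricSpace X] {f : ℝ → ι → X} {a b : ℝ} (hf : AbsolutelyContinuousOnInterval f a b)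
    (i : ι) : AbsolutelyContinuousOnInterval (fun s => f s i) a b :=
  (LipschitzWith.eval (α := fun _ : ι => X) i).comp_absolutelyContinuousOnInterval hf

theorem ContinuousOn.exists_first_hit {X : Type*} [TopologicalSpace X] {g : ℝ → X} {G : Set X}
    {T : ℝ} (hg : ContinuousOn g (Icc 0 T)) (hG : IsClosed G) (hne : ∃ s ∈ Icc 0 T, g s ∈ G) :
    ∃ τ ∈ Icc 0 T, g τ ∈ G ∧ ∀ s, 0 ≤ s → s < τ → g s ∉ G := by
  have hc : IsCompact (Icc 0 T ∩ g ⁻¹' G) :=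
    isCompact_Icc.of_isClosed_subset (hg.preimage_isClosed_of_isClosed isClosed_Icc hG)
      inter_subset_left
  obtain ⟨τ, hτ, hmin⟩ := hc.exists_isLeast hne
  exact ⟨τ, hτ.1, hτ.2, fun s h0 hs hsG => hs.not_ge (hmin ⟨⟨h0, hs.le.trans hτ.1.2⟩, hsG⟩)⟩

/-! ### Viable points and runs -/

namespace RobotTeam

variable {N d : ℕ} {m : Fin N → ℕ} {R : RobotTeam N d m}

theorem mem_Φi_of_mem_F {i : Fin N} {y v : EuclideanSpace ℝ (Fin d)} (hv : v ∈ R.F i y) :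
    (v, (-1 : ℝ)) ∈ R.Φi i y := by
  have h : (v, (-1 : ℝ)) ∈ R.F i y ×ˢ {(-1 : ℝ)} := ⟨hv, rfl⟩
  unfold Φi
  split_ifs
  · exact subset_closedConvexHull (Or.inl h)
  · exact h

theorem zero_mem_Φi {i : Fin N} {y : EuclideanSpace ℝ (Fin d)} (hy : y ∈ R.goal i) :
    ((0 : EuclideanSpace ℝ (Fin d)), (0 : ℝ)) ∈ R.Φi i y := by
  rw [Φi, if_pos hy]
  exact subset_closedConvexHull (Or.inr rfl)

theorem mem_Φi_iff_of_notMem_goal {i : Fin N} {y : EuclideanSpace ℝ (Fin d)} (hy : y ∉ R.goal i)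
    {w : EuclideanSpace ℝ (Fin d) × ℝ} : w ∈ R.Φi i y ↔ w.1 ∈ R.F i y ∧ w.2 = -1 := by
  rw [Φi, if_neg hy, mem_prod, mem_singleton_iff]

variable {K : Fin N → ℝ≥0} {L : Fin N → ℝ} {x : TeamState N d} {ξ : ℝ → TeamState N d}
  {τ : Fin N → ℝ}

theorem IsRun.lipschitzWith_sum (h : R.IsRun K L x ξ τ) : LipschitzWith (∑ i, K i) ξ := by
  refine LipschitzWith.of_dist_le_mul fun s r => (dist_pi_le_iff (by positivity)).2 fun i => ?_
  refine ((h.lipschitz i).dist_le_mul s r).trans (mul_le_mul_of_nonneg_right ?_ dist_nonneg)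
  exact_mod_cast Finset.single_le_sum (f := K) (fun _ _ => zero_le) (Finset.mem_univ i)

theorem ae_forall_ne (τ : Fin N → ℝ) : ∀ᵐ s : ℝ, ∀ i, s ≠ τ i :=
  ae_all_iff.2 fun i => by simp [ae_iff, measure_singleton]

/-- Letting the clock of each robot run until the robot stops shows that the start of a run, with
clocks set late enough, is viable. -/
theorem IsRun.mem_viabilityKernel (hreg : R.IsRegular) (h : R.IsRun K L x ξ τ)
    {t : Fin N → ℝ} (ht : τ ≤ t) :
    (x, t) ∈ viabilityKernel R.Φ R.safeTime := by
  have hclock : LipschitzWith 1 fun (s : ℝ) (i : Fin N) => t i - min s (τ i) := by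
    refine LipschitzWith.of_dist_le_mul fun s r => (dist_pi_le_iff (by positivity)).2 fun i => ?_
    have := (LipschitzWith.id.min_const (τ i)).dist_le_mul s r
    rw [dist_sub_left]
    exact this
  refine ⟨⟨h.start ▸ h.safe 0, fun i => (h.nonneg i).trans (ht i)⟩,
    fun s => (ξ s, fun i => t i - min s (τ i)), ?_, fun T hT => ⟨?_, ?_⟩, fun s hs => ⟨h.safe s, ?_⟩⟩
  · refine Prod.ext h.start (funext fun i => ?_)
    simp [min_eq_left (h.nonneg i)]
  · exact (h.lipschitzWith_sum.prodMk hclock).lipschitzOnWith.absolutelyContinuousOnInterval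
  -- The stopping times, where motion and clock may have corners, form a null set.
  · filter_upwards [ae_forall_ne τ, ae_all_iff.2 (h.ae_hasDerivAt hreg)] with s hne hd hsT
    have hw : ∀ i, ∃ w ∈ R.Φi i (ξ s i), HasDerivAt (fun s => ξ s i) w.1 s ∧
        HasDerivAt (fun s => t i - min s (τ i)) w.2 s := by
      intro i
      rcases (hne i).lt_or_gt with hlt | hgt
      · obtain ⟨v, hv, hdv⟩ := hd i ⟨hsT.1, hlt⟩
        refine ⟨(v, -1), mem_Φi_of_mem_F hv, hdv, ?_⟩
        refine ((hasDerivAt_id s).const_sub (t i)).congr_of_eventuallyEq ?_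
        filter_upwards [Iio_mem_nhds hlt] with r hr
        rw [min_eq_left (le_of_lt hr), id]
      · refine ⟨(0, 0), zero_mem_Φi (h.arrived i s hgt), h.hasDerivAt_zero hgt, ?_⟩
        refine (hasDerivAt_const s (t i - τ i)).congr_of_eventuallyEq ?_
        filter_upwards [Ioi_mem_nhds hgt] with r hr
        rw [min_eq_right (le_of_lt hr)]
    choose w hwΦ hw1 hw2 using hw
    exact ⟨(fun i => (w i).1, fun i => (w i).2), hwΦ,
      (hasDerivAt_pi.2 hw1).prodMk (hasDerivAt_pi.2 hw2)⟩
  · intro i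
    have := min_le_right s (τ i)
    have := ht i
    change 0 ≤ t i - min s (τ i)
    linarith

/-- From a viable pair of a state and clocks there is a run that beats the clocks. -/
theorem exists_isRun_of_mem_viabilityKernel (hreg : R.IsRegular)
    (hgoal : ∀ i, IsClosed (R.goal i)) (hb : R.IsBound K L) {t : Fin N → ℝ}
    (hx : (x, t) ∈ viabilityKernel R.Φ R.safeTime) : ∃ ξ τ, R.IsRun K L x ξ τ ∧ τ ≤ t := by
  obtain ⟨-, y, hy0, hsol, hyS⟩ := hx
  have hac1 : ∀ i T, 0 ≤ T → AbsolutelyContinuousOnInterval (fun s => (y s).1 i) 0 T :=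
    fun i T hT => (LipschitzWith.prod_fst.comp_absolutelyContinuousOnInterval (hsol T hT).1).apply i
  have hac2 : ∀ i T, 0 ≤ T → AbsolutelyContinuousOnInterval (fun s => (y s).2 i) 0 T :=
    fun i T hT => (LipschitzWith.prod_snd.comp_absolutelyContinuousOnInterval (hsol T hT).1).apply i
  have hd : ∀ i T, 0 ≤ T → (∀ s, 0 ≤ s → s < T → (y s).1 i ∉ R.goal i) →
      ∀ᵐ s : ℝ, s ∈ Ioo 0 T → (∃ v ∈ R.F i ((y s).1 i), HasDerivAt (fun s => (y s).1 i) v s) ∧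
        HasDerivAt (fun s => (y s).2 i) (-1) s := by
    intro i T hT hng
    filter_upwards [(hsol T hT).2] with s hs hsT
    obtain ⟨w, hw, hdw⟩ := hs hsT
    obtain ⟨hF, h1⟩ := (mem_Φi_iff_of_notMem_goal (hng s hsT.1.le hsT.2)).1 (hw i)
    refine ⟨⟨w.1 i, hF, hasDerivAt_pi.1 hdw.fst i⟩, ?_⟩
    have := hasDerivAt_pi.1 hdw.snd i
    change w.2 i = -1 at h1
    rwa [h1] at this
  have hle : ∀ i T, 0 ≤ T → (∀ s, 0 ≤ s → s < T → (y s).1 i ∉ R.goal i) → T ≤ t i := by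
    intro i T hT hng
    have h1 := (hac2 i T hT).sub_le_of_ae_hasDerivAt_le (c := -1) hT (by
      filter_upwards [hd i T hT hng] with s hs hsT
      exact ⟨-1, le_rfl, (hs hsT).2⟩)
    have h2 : 0 ≤ (y T).2 i := (hyS T hT).2 i
    have h3 : (y 0).2 i = t i := by rw [hy0]
    linarith
  have ht : ∀ i, 0 ≤ t i := fun i => hle i 0 le_rfl fun s h0 hs => absurd h0 hs.not_ge
  have hhit : ∀ i, ∃ τ, 0 ≤ τ ∧ (y τ).1 i ∈ R.goal i ∧
      ∀ s, 0 ≤ s → s < τ → (y s).1 i ∉ R.goal i := by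
    intro i
    -- Missing the goal on all of `[0, t i + 1]` would give `t i + 1 ≤ t i`.
    have hT : 0 ≤ t i + 1 := by linarith [ht i]
    have hcont := (hac1 i _ hT).continuousOn
    rw [uIcc_of_le hT] at hcont
    obtain ⟨τ, hτ, hτg, hτm⟩ := hcont.exists_first_hit (hgoal i) (by
      by_contra! hn
      linarith [hle i _ hT fun s h0 hs => hn s ⟨h0, hs.le⟩])
    exact ⟨τ, hτ.1, hτg, hτm⟩
  choose τ hτ0 hτg hτm using hhit
  have hrun := IsRun.of_stop hreg hb (y := fun s => (y s).1) hτ0 (fun i => hac1 i _ (hτ0 i))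
    (fun i => by
      filter_upwards [hd i _ (hτ0 i) (hτm i)] with s hs hsT
      exact (hs hsT).1) hτg fun s hs _ => (hyS s hs).1
  simp only [hy0] at hrun
  exact ⟨_, τ, hrun, fun i => hle i _ (hτ0 i) (hτm i)⟩

/-! ### Arrival times and feedback policies -/

/-- A finite vector of minimal arrival times is attained, and realized by a run. -/
theorem exists_isRun_of_arrivalTime_ne_top (hreg : R.IsRegular)
    (hgoal : ∀ i, IsClosed (R.goal i)) (hb : R.IsBound K L) {π : R.Policy}
    (hπ : R.IsAdmissible π) (hfin : ∀ i, R.arrivalTime x π ξ i ≠ ∞) :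
    ∃ ξ' τ, R.IsRun K L x ξ' τ ∧ R.arrivalTime x π ξ = fun i => ENNReal.ofReal (τ i) := by
  rcases isEmpty_or_nonempty (Fin N) with hN | ⟨⟨i₀⟩⟩
  · exact ⟨_, isEmptyElim, IsRun.of_stop hreg hb (y := fun _ => x) isEmptyElim isEmptyElim
      isEmptyElim isEmptyElim (fun s _ ⟨j, _⟩ => isEmptyElim j), Subsingleton.elim _ _⟩
  -- Finiteness of an infimum entry gives an arrival vector finite in that entry only, so each robot
  -- uses its own vector.
  have hex : ∀ i, ∃ w ∈ R.arrivalVectors x π ξ, w i ≠ ∞ := by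
    intro i
    by_contra! hn
    refine hfin i ?_
    rw [arrivalTime, sInf_apply, iInf_eq_top]
    exact fun w => hn w w.2
  choose w hwA hwfin using hex
  have hsol : ∀ i (T : ℝ), 0 ≤ T → T ≤ (w i i).toReal →
      IsSolutionOn (fun y => {R.velocity π y}) ξ T ∧ ξ T ∈ R.safeRegion := by
    intro i T hT hTw
    lift T to ℝ≥0 using hT
    refine (hwA i).2.1 T ⟨i, ?_⟩
    rw [← ENNReal.ofReal_toReal (hwfin i), ← ENNReal.ofReal_coe_nnreal]
    exact ENNReal.ofReal_le_ofReal hTw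
  have hac : ∀ i T, 0 ≤ T → T ≤ (w i i).toReal →
      AbsolutelyContinuousOnInterval (fun s => ξ s i) 0 T := fun i T h0 h1 =>
    (hsol i T h0 h1).1.1.apply i
  have hhit : ∀ i, ∃ τ ∈ Icc 0 (w i i).toReal, ξ τ i ∈ R.goal i ∧
      ∀ s, 0 ≤ s → s < τ → ξ s i ∉ R.goal i := by
    intro i
    have hcont := (hac i _ ENNReal.toReal_nonneg le_rfl).continuousOn
    rw [uIcc_of_le ENNReal.toReal_nonneg] at hcont
    exact hcont.exists_first_hit (hgoal i)
      ⟨_, ⟨ENNReal.toReal_nonneg, le_rfl⟩, (hwA i).2.2 i (hwfin i)⟩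
  choose τ hτ hτg hτm using hhit
  have hsafe : ∀ s, 0 ≤ s → (∃ j, s ≤ τ j) → ξ s ∈ R.safeRegion := fun s hs ⟨j, hj⟩ =>
    (hsol j s hs (hj.trans (hτ j).2)).2
  have hrun := IsRun.of_stop hreg hb (fun i => (hτ i).1) (fun i => hac i _ (hτ i).1 (hτ i).2)
    (fun i => by
      filter_upwards [(hsol i _ (hτ i).1 (hτ i).2).1.2] with s hs hsT
      obtain ⟨v, hv, hd⟩ := hs hsT
      -- Resting is allowed only in the goal, so before its first hit the robot applies a control.
      have hng := hτm i s hsT.1.le hsT.2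
      have hX := safeRegion_subset_stateSpace (hsafe s hsT.1.le ⟨i, hsT.2.le⟩)
      refine ⟨v i, ?_, hasDerivAt_pi.1 hd i⟩
      rw [mem_singleton_iff.1 hv, velocity]
      cases hu : π i (ξ s) with
      | none => exact absurd ((hπ _ hX i).2 hu) hng
      | some u => exact ⟨u, (hπ _ hX i).1 u hu, rfl⟩) hτg hsafe
  rw [(hwA i₀).1] at hrun
  refine ⟨_, τ, hrun, IsGLB.sInf_eq (IsLeast.isGLB ⟨⟨(hwA i₀).1, ?_, ?_⟩, ?_⟩)⟩
  · rintro T ⟨j, hj⟩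
    have hj' : (T : ℝ) ≤ τ j := by
      rw [← ENNReal.ofReal_coe_nnreal] at hj
      exact (ENNReal.ofReal_le_ofReal_iff (hτ j).1).1 hj
    exact hsol j T T.2 (hj'.trans (hτ j).2)
  · intro i _
    rw [ENNReal.toReal_ofReal (hτ i).1]
    exact hτg i
  · intro v hv i
    by_cases hvi : v i = ∞
    · rw [hvi]
      exact le_top
    · refine ENNReal.ofReal_le_of_le_toReal (not_lt.1 fun hlt => ?_)
      exact hτm i _ ENNReal.toReal_nonneg hlt (hv.2.2 i hvi)

/-- Cutting a loop out of a run gives a run with earlier arrivals. -/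
theorem IsRun.exists_lt_of_eq (hreg : R.IsRegular) (hgoal : ∀ i, IsClosed (R.goal i))
    (hb : R.IsBound K L) (h : R.IsRun K L x ξ τ) {a b : ℝ} (ha : 0 ≤ a) (hab : a < b)
    (hbτ : ∃ j, b ≤ τ j) (heq : ξ a = ξ b) : ∃ ξ' τ', R.IsRun K L x ξ' τ' ∧ τ' < τ := by
  set y : ℝ → TeamState N d := fun s => if s ≤ a then ξ s else ξ (s + (b - a)) with hy
  have hy1 : ∀ s, s ≤ a → y s = ξ s := fun s hs => if_pos hs
  have hy2 : ∀ s, a ≤ s → y s = ξ (s + (b - a)) := by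
    intro s hs
    rcases hs.eq_or_lt with rfl | hs
    · rw [hy1 _ le_rfl, heq]
      congr 1
      ring
    · exact if_neg hs.not_ge
  have hlip : ∀ i s r, s ≤ r → dist (y s i) (y r i) ≤ K i * (r - s) := by
    have hl : ∀ i s r, s ≤ r → dist (ξ s i) (ξ r i) ≤ K i * (r - s) := by
      intro i s r hsr
      have := (h.lipschitz i).dist_le_mul s r
      rwa [dist_comm s, Real.dist_eq, abs_of_nonneg (sub_nonneg.2 hsr)] at this
    intro i s r hsr
    rcases le_total r a with hr | hr
    · rw [hy1 r hr, hy1 s (hsr.trans hr)]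
      exact hl i s r hsr
    rcases le_total s a with hs | hs
    -- Across the cut, the two estimates are joined through `ξ a = ξ b`.
    · refine (dist_triangle _ (ξ a i) _).trans ?_
      have h1 := hl i s a hs
      have h2 := hl i b (r + (b - a)) (by linarith)
      rw [hy1 s hs, hy2 r hr]
      nth_rewrite 2 [heq]
      linarith
    · rw [hy2 s hs, hy2 r hr]
      refine (hl i _ _ (by linarith)).trans_eq ?_
      ring
  have hlip' : ∀ i, LipschitzWith (K i) fun s => y s i := by
    refine fun i => LipschitzWith.of_dist_le_mul fun s r => ?_
    rcases le_total s r with hsr | hsr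
    · rw [dist_comm s, Real.dist_eq, abs_of_nonneg (sub_nonneg.2 hsr)]
      exact hlip i s r hsr
    · rw [dist_comm (y s i), Real.dist_eq, abs_of_nonneg (sub_nonneg.2 hsr)]
      exact hlip i r s hsr
  -- The length of `[0, τ i]` left after removing `[a, b]`. A robot that stops inside the loop now
  -- stops at `a`, in its goal because `ξ a = ξ b`.
  set τ' : Fin N → ℝ := fun i => min (τ i) a + max (τ i - b) 0 with hτ'
  have hτ'0 : ∀ i, 0 ≤ τ' i := fun i => add_nonneg (le_min (h.nonneg i) ha) (le_max_right _ _)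
  have hτ'1 : ∀ i, τ i ≤ a → τ' i = τ i := by
    intro i hi
    simp only [hτ', min_eq_left hi, max_eq_right (by linarith : τ i - b ≤ 0), add_zero]
  have hτ'2 : ∀ i, a ≤ τ i → τ i ≤ b → τ' i = a := by
    intro i h1 h2
    simp only [hτ', min_eq_right h1, max_eq_right (by linarith : τ i - b ≤ 0), add_zero]
  have hτ'3 : ∀ i, b ≤ τ i → τ' i = τ i - (b - a) := by
    intro i h1
    simp only [hτ', min_eq_right (hab.le.trans h1), max_eq_left (by linarith : 0 ≤ τ i - b)]
    ring
  have hysafe : ∀ s, y s ∈ R.safeRegion := by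
    intro s
    rcases le_total s a with hs | hs
    · exact hy1 s hs ▸ h.safe s
    · exact hy2 s hs ▸ h.safe _
  have hshift : ∀ i, ∀ᵐ s : ℝ, s + (b - a) ∈ Ioo 0 (τ i) →
      ∃ v ∈ R.F i (ξ (s + (b - a)) i), HasDerivAt (fun s => ξ s i) v (s + (b - a)) := fun i =>
    (measurePreserving_add_right volume (b - a)).quasiMeasurePreserving.ae (h.ae_hasDerivAt hreg i)
  have hrun := IsRun.of_stop hreg hb (y := y) hτ'0
    (fun i => (hlip' i).lipschitzOnWith.absolutelyContinuousOnInterval) (fun i => by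
      filter_upwards [h.ae_hasDerivAt hreg i, hshift i, ae_forall_ne fun _ : Fin N => a]
        with s h1 h2 h3 hs
      rcases (h3 i).lt_or_gt with hsa | hsa
      · have hsτ : s < τ i := by
          by_contra! hn
          have := hτ'1 i (hn.trans hsa.le)
          linarith [hs.2]
        obtain ⟨v, hv, hd⟩ := h1 ⟨hs.1, hsτ⟩
        refine ⟨v, by rwa [hy1 s hsa.le], hd.congr_of_eventuallyEq ?_⟩
        filter_upwards [Iio_mem_nhds hsa] with r hr
        rw [hy1 r (le_of_lt hr)]
      · have hsτ : s + (b - a) < τ i := by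
          rcases le_total (τ i) a with hi | hi
          · linarith [hτ'1 i hi, hs.2]
          rcases le_total (τ i) b with hi' | hi'
          · linarith [hτ'2 i hi hi', hs.2]
          · linarith [hτ'3 i hi', hs.2]
        obtain ⟨v, hv, hd⟩ := h2 ⟨by linarith [hs.1], hsτ⟩
        refine ⟨v, by rwa [hy2 s hsa.le],
          (hd.comp_add_const s (b - a)).congr_of_eventuallyEq ?_⟩
        filter_upwards [Ioi_mem_nhds hsa] with r hr
        rw [hy2 r (le_of_lt hr)])
    (fun i => by
      rcases le_total (τ i) a with hi | hi
      · rw [hτ'1 i hi, hy1 _ hi]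
        exact h.arrived_of_le hgoal le_rfl
      rcases le_total (τ i) b with hi' | hi'
      · rw [hτ'2 i hi hi', hy1 _ le_rfl, heq]
        exact h.arrived_of_le hgoal hi'
      · rw [hτ'3 i hi', hy2 _ (by linarith), sub_add_cancel]
        exact h.arrived_of_le hgoal le_rfl) fun s _ _ => hysafe s
  rw [hy1 0 ha, h.start] at hrun
  refine ⟨_, τ', hrun, Pi.lt_def.2 ⟨fun i => ?_, ?_⟩⟩
  · rcases le_total (τ i) a with hi | hi
    · exact (hτ'1 i hi).le
    rcases le_total (τ i) b with hi' | hi'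
    · exact (hτ'2 i hi hi').trans_le hi
    · linarith [hτ'3 i hi']
  · obtain ⟨j, hj⟩ := hbτ
    exact ⟨j, by linarith [hτ'3 j hj]⟩

/-- A run that no run beats does not visit a joint state twice, hence is driven by a feedback
policy. -/
theorem IsRun.exists_policy_of_minimal (hreg : R.IsRegular) (hgoal : ∀ i, IsClosed (R.goal i))
    (hb : R.IsBound K L) (h : R.IsRun K L x ξ τ)
    (hmin : ∀ ξ' τ', R.IsRun K L x ξ' τ' → ¬ τ' < τ) :
    ∃ π : R.Policy, R.IsAdmissible π ∧
      (fun i => ENNReal.ofReal (τ i)) ∈ R.arrivalVectors x π ξ := by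
  classical
  have hinj : ∀ a b, 0 ≤ a → 0 ≤ b → (∃ j, a ≤ τ j) → (∃ j, b ≤ τ j) → ξ a = ξ b → a = b := by
    have key : ∀ a b, 0 ≤ a → (∃ j, b ≤ τ j) → ξ a = ξ b → ¬ a < b := by
      intro a b ha hbτ heq hab
      obtain ⟨ξ', τ', hrun, hlt⟩ := h.exists_lt_of_eq hreg hgoal hb ha hab hbτ heq
      exact hmin ξ' τ' hrun hlt
    intro a b ha hb' haτ hbτ heq
    exact le_antisymm (not_lt.1 (key b a hb' haτ heq.symm)) (not_lt.1 (key a b ha hbτ heq))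
  -- `u` reproduces the velocity of robot `i` at some visit to `z` before its stop. Such visits
  -- happen at one time only, so whichever control is chosen fits the run.
  let P : (i : Fin N) → TeamState N d → EuclideanSpace ℝ (Fin (m i)) → Prop := fun i z u =>
    u ∈ R.U i ∧ ∃ s, 0 ≤ s ∧ s < τ i ∧ ξ s = z ∧ HasDerivAt (fun s => ξ s i) (R.f i (z i) u) s
  let π : R.Policy := fun i z =>
    if hz : ∃ u, P i z u then some hz.choose
    else if z i ∈ R.goal i then none else some (hreg.U_nonempty i).some
  have hπ1 : ∀ i z (hz : ∃ u, P i z u), π i z = some hz.choose := fun i z hz => dif_pos hz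
  have hπ2 : ∀ i z, (¬ ∃ u, P i z u) → z i ∈ R.goal i → π i z = none := fun i z hz hg => by
    simp only [π, dif_neg hz, if_pos hg]
  have hπ3 : ∀ i z, (¬ ∃ u, P i z u) → z i ∉ R.goal i →
      π i z = some (hreg.U_nonempty i).some := fun i z hz hg => by
    simp only [π, dif_neg hz, if_neg hg]
  refine ⟨π, fun z _ i => ?_, h.start, ?_, fun i _ => ?_⟩
  · by_cases hz : ∃ u, P i z u
    · rw [hπ1 i z hz]
      refine ⟨fun u hu => ?_, fun hu => by simp at hu⟩
      rw [← Option.some_inj.1 hu]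
      exact hz.choose_spec.1
    by_cases hg : z i ∈ R.goal i
    · rw [hπ2 i z hz hg]
      exact ⟨fun u hu => by simp at hu, fun _ => hg⟩
    · rw [hπ3 i z hz hg]
      refine ⟨fun u hu => ?_, fun hu => by simp at hu⟩
      rw [← Option.some_inj.1 hu]
      exact (hreg.U_nonempty i).some_mem
  · rintro T ⟨j, hj⟩
    have hTj : (T : ℝ) ≤ τ j := by
      rw [← ENNReal.ofReal_coe_nnreal] at hj
      exact (ENNReal.ofReal_le_ofReal_iff (h.nonneg j)).1 hj
    refine ⟨⟨h.lipschitzWith_sum.lipschitzOnWith.absolutelyContinuousOnInterval, ?_⟩, h.safe T⟩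
    filter_upwards [ae_forall_ne τ, ae_all_iff.2 (h.ae_hasDerivAt hreg)] with s hne hd hsT
    have hsj : s ≤ τ j := hsT.2.le.trans hTj
    refine ⟨_, rfl, hasDerivAt_pi.2 fun i => ?_⟩
    have huniq : ∀ u, P i (ξ s) u →
        s < τ i ∧ HasDerivAt (fun s => ξ s i) (R.f i (ξ s i) u) s := by
      rintro u ⟨-, r, hr0, hri, hrs, hdr⟩
      obtain rfl := hinj r s hr0 hsT.1.le ⟨i, hri.le⟩ ⟨j, hsj⟩ hrs
      exact ⟨hri, hdr⟩
    rw [velocity]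
    rcases (hne i).lt_or_gt with hlt | hgt
    · obtain ⟨_, ⟨u, hu, rfl⟩, hdv⟩ := hd i ⟨hsT.1, hlt⟩
      have hz : ∃ u, P i (ξ s) u := ⟨u, hu, s, hsT.1.le, hlt, rfl, hdv⟩
      rw [hπ1 i _ hz]
      exact (huniq _ hz.choose_spec).2
    · rw [hπ2 i _ (fun ⟨u, hu⟩ => hgt.not_gt (huniq u hu).1) (h.arrived i s hgt)]
      exact h.hasDerivAt_zero hgt
  · rw [ENNReal.toReal_ofReal (h.nonneg i)]
    exact h.arrived_of_le hgoal le_rfl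

/-- Minimize the sum of the stopping times over the compact set of runs below `τ`. A run beating the
minimizer would lie in the same set and have a smaller sum. -/
theorem IsRun.exists_minimal (hreg : R.IsRegular) (hgoal : ∀ i, IsClosed (R.goal i))
    (hsafe : IsClosed R.safeRegion) (h : R.IsRun K L x ξ τ) :
    ∃ ξ' τ', R.IsRun K L x ξ' τ' ∧ τ' ≤ τ ∧ ∀ ξ'' τ'', R.IsRun K L x ξ'' τ'' → ¬ τ'' < τ' := by
  obtain ⟨p, ⟨hp, hpτ⟩, hmin⟩ := (isCompact_setOf_isRun hreg hgoal hsafe K L x τ).exists_isMinOn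
    ⟨(ξ, τ), h, le_rfl⟩ (f := fun p => ∑ i, p.2 i) (by fun_prop)
  refine ⟨p.1, p.2, hp, hpτ, fun ξ'' τ'' h'' hlt => ?_⟩
  have h1 : ∑ i, p.2 i ≤ ∑ i, τ'' i :=
    hmin (show (ξ'', τ'') ∈ {p : (ℝ → TeamState N d) × (Fin N → ℝ) |
      R.IsRun K L x p.1 p.2 ∧ p.2 ≤ τ} from ⟨h'', hlt.le.trans hpτ⟩)
  obtain ⟨hle, j, hj⟩ := Pi.lt_def.1 hlt
  exact h1.not_gt (Finset.sum_lt_sum (fun i _ => hle i) ⟨j, Finset.mem_univ j, hj⟩)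

end RobotTeam

end

/-! ### The two inclusions -/

theorem mainTheorem4 (N d : ℕ) (m : Fin N → ℕ) (R : RobotTeam N d m)
    (hR : R.IsWellFormed) (hreg : R.IsRegular)
    (hgoal : ∀ i, IsClosed (R.goal i)) (hsafe : IsClosed R.safeRegion) :
    viabilityKernel R.Φ R.safeTime = R.epigraph R.minimalArrival := by
  obtain ⟨K, L, hb⟩ := hreg.exists_isBound
  ext ⟨x, t⟩
  constructor
  · intro hx
    obtain ⟨ξ₀, τ₀, hrun₀, hle₀⟩ :=
      RobotTeam.exists_isRun_of_mem_viabilityKernel hreg hgoal hb hx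
    obtain ⟨ξ, τ, hrun, hle, hmin⟩ := hrun₀.exists_minimal hreg hgoal hsafe
    obtain ⟨π, hπ, harr⟩ := hrun.exists_policy_of_minimal hreg hgoal hb hmin
    -- An arrival vector below `τ` is finite, hence realized by a run, which cannot beat the minimal
    -- one. Applied to `π` and `ξ` this identifies their arrival vector; applied to competitors it
    -- gives Pareto optimality.
    have huniq : ∀ π' ξ', R.IsAdmissible π' →
        R.arrivalTime x π' ξ' ≤ (fun i => ENNReal.ofReal (τ i)) →
        R.arrivalTime x π' ξ' = fun i => ENNReal.ofReal (τ i) := by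
      intro π' ξ' hπ' hle'
      obtain ⟨ξ'', τ'', hrun'', heq⟩ := RobotTeam.exists_isRun_of_arrivalTime_ne_top hreg hgoal hb
        hπ' fun i => ((hle' i).trans_lt ENNReal.ofReal_lt_top).ne
      have hττ : τ'' ≤ τ := fun i => by
        have := hle' i
        rw [heq] at this
        exact (ENNReal.ofReal_le_ofReal_iff (hrun.nonneg i)).1 this
      rw [heq, eq_of_le_of_not_lt hττ (hmin ξ'' τ'' hrun'')]
    have hval := huniq π ξ hπ (sInf_le harr)
    refine ⟨RobotTeam.safeRegion_subset_stateSpace hx.1.1, _, ⟨(π, ξ), ⟨hπ, ?_⟩, rfl⟩, fun i => ?_⟩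
    · rintro ⟨π', ξ', hπ', hne, hle'⟩
      rw [hval] at hne hle'
      exact hne (huniq π' ξ' hπ' hle')
    · simp only [hval]
      rw [EReal.coe_ennreal_ofReal, max_eq_left (hrun.nonneg i)]
      exact EReal.coe_le_coe_iff.2 ((hle i).trans (hle₀ i))
  · rintro ⟨-, _, ⟨⟨π, ξ⟩, ⟨hπ, -⟩, rfl⟩, hle⟩
    -- The entries of `t` are real, so the arrival vector below it is finite.
    obtain ⟨ξ', τ, hrun, heq⟩ := RobotTeam.exists_isRun_of_arrivalTime_ne_top (ξ := ξ) (x := x)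
      hreg hgoal hb hπ fun i hi => by
        have := hle i
        simp only [hi] at this
        exact (EReal.coe_lt_top (t i)).not_ge this
    refine hrun.mem_viabilityKernel hreg fun i => ?_
    have := hle i
    simp only [heq] at this
    rw [EReal.coe_ennreal_ofReal, max_eq_left (hrun.nonneg i)] at this
    exact EReal.coe_le_coe_iff.1 this
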